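/- Let $G$ be a finite group with commutator subgroup $G' = \langle xyx^{-1}y^{-1} : x,y\in G\rangle$. Let $\mathcal F(G)$ be the free abelian monoid with basis $G$; its elements are the finite unordered sequences of terms from $G$, with repetition allowed, and its operation is written $\cdot$. For $S = g_1\cdot\ldots\cdot g_\ell \in \mathcal F(G)$ let $\pi(S) = \{ g_{\tau(1)}\cdots g_{\tau(\ell)} : \tau \text{ a permutation of } \{1,\dots,\ell\}\}\subset G$, with $\pi(S)=\{1_G\}$ if $S$ is empty, and let $\mathcal B(G) = \{ S\in\mathcal F(G) : 1_G\in\pi(S)\}$ be the monoid of product-one sequences over $G$. Call $S,S'\in\mathcal F(G)$ equivalent if, for all $T\in\mathcal F(G)$, $S\cdot T\in\mathcal B(G)$ if and only if $S'\cdot T\in\mathcal B(G)$. This is a congruence on $\mathcal F(G)$, and the commutative semigroup $\mathcal C(\mathcal B(G),\mathcal F(G))$ of its congruence classes is called the class semigroup. A commutative semigroup is called a Clifford semigroup if each of its elements lies in a subgroup, that is, in a subsemigroup which is a group under the induced operation (its identity element may differ from that of the whole semigroup). **Theorem.** If $\mathcal C(\mathcal B(G),\mathcal F(G))$ is a Clifford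 semigroup, then $|G'|\le 2$. -/

import Mathlib

namespace ClassSemigroup

/-- `H`-equivalence on a commutative monoid `F` (written additively), for a submonoid `H ⊆ F`:
two elements `y, y'` are equivalent if `(-y + H) ∩ F = (-y' + H) ∩ F`, that is, if the sets
`{z ∈ F | y + z ∈ H}` and `{z ∈ F | y' + z ∈ H}` coincide. This is a congruence on `F`. -/
def equivalence {F : Type*} [AddCommMonoid F] (H : AddSubmonoid F) : AddCon F where
  r y y' := {z : F | y + z ∈ H} = {z : F | y' + z ∈ H}
  iseqv := ⟨fun _ => rfl, fun h => h.symm, fun h h' => h.trans h'⟩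
  add' := by
    intro w x y z hwx hyz
    ext t
    have h₁ := Set.ext_iff.mp hwx (y + t)
    have h₂ := Set.ext_iff.mp hyz (x + t)
    simp only [Set.mem_ofPred_eq] at h₁ h₂ ⊢
    rw [add_assoc, h₁, add_left_comm, h₂, add_left_comm, add_assoc]

/-- The class semigroup `C(H, F)`, with the addition induced from `F`. -/
abbrev _root_.ClassSemigroup {F : Type*} [AddCommMonoid F] (H : AddSubmonoid F) : Type _ :=
  (equivalence H).Quotient

/-- A subsemigroup of a commutative semigroup that is a group under the induced addition. Its
identity element `e` need not be the identity element of the ambient semigroup. -/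
def IsSubgroup {C : Type*} [AddCommSemigroup C] (T : AddSubsemigroup C) : Prop :=
  ∃ e ∈ T, (∀ x ∈ T, e + x = x) ∧ ∀ x ∈ T, ∃ y ∈ T, x + y = e

/-- An element is regular if it lies in a subgroup of the semigroup. -/
def IsRegularElement {C : Type*} [AddCommSemigroup C] (a : C) : Prop :=
  ∃ T : AddSubsemigroup C, IsSubgroup T ∧ a ∈ T

/-- A commutative semigroup is a Clifford semigroup if all its elements are regular. -/
def IsClifford (C : Type*) [AddCommSemigroup C] : Prop :=
  ∀ a : C, IsRegularElement a

/-- The set of products `π(S)` of a sequence `S` over `G`, that is, of a finite unordered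
sequence with repetition allowed (an element of the free abelian monoid `F(G) = Multiset G`):
all products of the terms of `S`, in any order. For the empty sequence it is `{1}`. -/
def productSet {G : Type*} [Group G] (S : Multiset G) : Set G :=
  {g | ∃ l : List G, (l : Multiset G) = S ∧ l.prod = g}

/-- The monoid `B(G)` of product-one sequences over `G`, as a submonoid of `F(G)`. -/
def productOneMonoid (G : Type*) [Group G] : AddSubmonoid (Multiset G) where
  carrier := {S | (1 : G) ∈ productSet S}
  zero_mem' := ⟨[], rfl, rfl⟩
  add_mem' := by
    rintro _ _ ⟨l, rfl, hl⟩ ⟨m, rfl, hm⟩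
    exact ⟨l ++ m, by simp, by simp [hl, hm]⟩

end ClassSemigroup

namespace ClassSemigroup

/-! In a Clifford class semigroup, `S` is equivalent to `S + k • (S + T)` for some `T`; with `k =
|G|` the padding supplies spare copies of the terms of `S` at no cost, since |G|-th powers are
trivial. Padding `g` puts g²hg⁻¹ into {gh, hg}, so squares are central and commutators form a
central, symmetric, bimultiplicative form of exponent two. Padding `g·h` puts ghgxg⁻¹ into π(g·h·x),
so no triple has three distinct nontrivial mutual commutators. By bimultiplicativity only one
nontrivial commutator remains, and it generates G'. -/

theorem IsRegularElement.exists_add_nsmul_eq {C : Type*} [AddCommMonoid C] {a : C}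
    (ha : IsRegularElement a) : ∃ t : C, ∀ k : ℕ, a + k • (a + t) = a := by
  obtain ⟨T, ⟨e, -, hid, hinv⟩, haT⟩ := ha
  obtain ⟨t, -, ht⟩ := hinv a haT
  refine ⟨t, fun k => ?_⟩
  -- Here `a + t` is the identity of the subgroup containing `a`.
  rw [ht]
  induction k with
  | zero => simp
  | succ k ih => rw [succ_nsmul, ← add_assoc, ih, add_comm, hid a haT]

/-! ### Product sets and padding -/

section Group

variable {G : Type*} [Group G]

theorem mem_productOneMonoid {S : Multiset G} :
    S ∈ productOneMonoid G ↔ (1 : G) ∈ productSet S :=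
  Iff.rfl

/-- A word with product one keeps it under rotation, so `r⁻¹` can be moved to the front. Hence the
class of `S` determines every `productSet (S + U)`. -/
theorem one_mem_productSet_add_inv_iff {S : Multiset G} {r : G} :
    (1 : G) ∈ productSet (S + {r⁻¹}) ↔ r ∈ productSet S := by
  constructor
  · rintro ⟨l, hl, hprod⟩
    have hr : r⁻¹ ∈ l := by
      rw [← Multiset.mem_coe, hl]
      simp
    obtain ⟨l₁, l₂, rfl⟩ := List.append_of_mem hr
    refine ⟨l₂ ++ l₁, ?_, ?_⟩
    · have h : (r⁻¹ ::ₘ ((l₂ ++ l₁ : List G) : Multiset G)) = r⁻¹ ::ₘ S := by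
        rw [Multiset.cons_coe, ← Multiset.singleton_add r⁻¹ S, add_comm {r⁻¹} S, ← hl,
          Multiset.coe_eq_coe]
        exact (List.perm_append_comm (l₁ := r⁻¹ :: l₂) (l₂ := l₁))
      exact (Multiset.cons_inj_right _).1 h
    · simp only [List.prod_append, List.prod_cons] at hprod ⊢
      have h : l₁.prod⁻¹ = r⁻¹ * l₂.prod := inv_eq_of_mul_eq_one_right hprod
      rw [← inv_inv l₁.prod, h]
      group
  · rintro ⟨l, rfl, rfl⟩
    exact ⟨l ++ [l.prod⁻¹], by simp [← Multiset.coe_add], by simp⟩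

/-- In a Clifford class semigroup, every `S` can be padded by multiples of a suitable sequence
containing `S` without changing the product sets of the sequences containing `S`. -/
theorem IsClifford.exists_productSet_eq
    (hC : IsClifford (ClassSemigroup (productOneMonoid G))) (S : Multiset G) :
    ∃ T : Multiset G, ∀ (k : ℕ) (U : Multiset G),
      productSet (S + k • (S + T) + U) = productSet (S + U) := by
  obtain ⟨t, ht⟩ := (hC (S : (equivalence (productOneMonoid G)).Quotient)).exists_add_nsmul_eq
  induction t using AddCon.induction_on with
  | H T =>
    refine ⟨T, fun k U => ?_⟩
    have h : equivalence (productOneMonoid G) (S + k • (S + T)) S :=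
      (AddCon.eq _).1 (ht k)
    ext r
    rw [← one_mem_productSet_add_inv_iff, ← one_mem_productSet_add_inv_iff (S := S + U), add_assoc,
      add_assoc]
    have hU := Set.ext_iff.1 h (U + {r⁻¹})
    rw [Set.mem_ofPred_eq, Set.mem_ofPred_eq, mem_productOneMonoid, mem_productOneMonoid] at hU
    rw [add_assoc S U]
    simpa only [add_assoc] using hU

theorem productSet_pair {g h r : G} (hr : r ∈ productSet ({g} + {h})) :
    r = g * h ∨ r = h * g := by
  obtain ⟨l, hl, rfl⟩ := hr
  have hp : l ∈ [g, h].permutations :=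
    List.mem_permutations.2 (Multiset.coe_eq_coe.1 hl)
  simp [List.permutations] at hp
  rcases hp with rfl | rfl <;> simp

theorem productSet_triple {g h x r : G} (hr : r ∈ productSet ({g} + {h} + {x})) :
    r = g * h * x ∨ r = g * x * h ∨ r = h * g * x ∨ r = h * x * g ∨ r = x * g * h ∨
      r = x * h * g := by
  obtain ⟨l, hl, rfl⟩ := hr
  have hp : l ∈ [g, h, x].permutations :=
    List.mem_permutations.2 (Multiset.coe_eq_coe.1 hl)
  simp [List.permutations] at hp
  rcases hp with rfl | rfl | rfl | rfl | rfl | rfl <;> simp [mul_assoc]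

theorem exists_coe_eq_nsmul (T : Multiset G) (n : ℕ) :
    ∃ l : List G, (l : Multiset G) = n • T ∧ l.prod = T.toList.prod ^ n := by
  induction n with
  | zero => exact ⟨[], by simp, by simp⟩
  | succ n ih =>
    obtain ⟨l, hl, hprod⟩ := ih
    exact ⟨l ++ T.toList, by rw [← Multiset.coe_add, hl, Multiset.coe_toList, succ_nsmul],
      by rw [List.prod_append, hprod, pow_succ]⟩

variable [Finite G]

theorem IsClifford.sq_mul_comm (hC : IsClifford (ClassSemigroup (productOneMonoid G)))
    (g h : G) : g ^ 2 * h = h * g ^ 2 := by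
  obtain ⟨T, hT⟩ := hC.exists_productSet_eq {g}
  obtain ⟨n, hn⟩ := Nat.exists_eq_succ_of_ne_zero (Nat.card_pos (α := G)).ne'
  obtain ⟨l, hl, hprod⟩ := exists_coe_eq_nsmul T (Nat.card G)
  have hg : g ^ n = g⁻¹ := by
    rw [eq_inv_iff_mul_eq_one, ← pow_succ, ← Nat.succ_eq_add_one, ← hn, pow_card_eq_one']
  have hmem : g * g * h * g⁻¹ ∈ productSet ({g} + {h}) := by
    rw [← hT (Nat.card G)]
    -- The padded sequence has 1 + |G| = n + 2 copies of `g`: two in front, and `n` with product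
    -- `g⁻¹`.
    refine ⟨[g, g, h] ++ List.replicate n g ++ l, ?_, ?_⟩
    · rw [← Multiset.coe_add, ← Multiset.coe_add, hl, Multiset.coe_replicate,
        ← Multiset.nsmul_singleton, nsmul_add, hn, Nat.succ_eq_add_one]
      have h3 : (([g, g, h] : List G) : Multiset G) = {g} + {g} + {h} := rfl
      rw [h3, succ_nsmul ({g} : Multiset G)]
      abel
    · simp [hprod, hg, mul_assoc]
  rcases productSet_pair hmem with h1 | h1
  · have h2 : g * h = h * g := by
      rw [mul_inv_eq_iff_eq_mul, mul_assoc, mul_assoc] at h1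
      exact mul_left_cancel h1
    rw [pow_two, mul_assoc, h2, ← mul_assoc, h2, mul_assoc]
  · rw [pow_two, mul_inv_eq_iff_eq_mul.1 h1, mul_assoc]

theorem IsClifford.conj_mem_productSet (hC : IsClifford (ClassSemigroup (productOneMonoid G)))
    (g h x : G) : g * h * g * x * g⁻¹ ∈ productSet ({g} + {h} + {x}) := by
  obtain ⟨T, hT⟩ := hC.exists_productSet_eq ({g} + {h})
  obtain ⟨n, hn⟩ := Nat.exists_eq_succ_of_ne_zero (Nat.card_pos (α := G)).ne'
  obtain ⟨l, hl, hprod⟩ := exists_coe_eq_nsmul T (Nat.card G)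
  have hg : g ^ n = g⁻¹ := by
    rw [eq_inv_iff_mul_eq_one, ← pow_succ, ← Nat.succ_eq_add_one, ← hn, pow_card_eq_one']
  rw [← hT (Nat.card G)]
  refine ⟨[g, h, g, x] ++ List.replicate n g ++ List.replicate (Nat.card G) h ++ l, ?_, ?_⟩
  · rw [← Multiset.coe_add, ← Multiset.coe_add, ← Multiset.coe_add, hl, Multiset.coe_replicate,
      Multiset.coe_replicate, ← Multiset.nsmul_singleton, ← Multiset.nsmul_singleton, nsmul_add,
      nsmul_add]
    have h4 : (([g, h, g, x] : List G) : Multiset G) = {g} + {h} + {g} + {x} := rfl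
    have h5 : Nat.card G • ({g} : Multiset G) = n • {g} + {g} := by
      rw [hn, Nat.succ_eq_add_one, succ_nsmul]
    rw [h4, h5]
    abel
  · simp [hprod, hg, mul_assoc]

end Group

end ClassSemigroup

open scoped commutatorElement IsMulCommutative

/-! ### The commutator form when squares are central -/

section CentralSquares

variable {G : Type*} [Group G]

theorem commutatorElement_mem_center_of_sq_mem (hsq : ∀ g : G, g ^ 2 ∈ Subgroup.center G)
    (g h : G) : ⁅g, h⁆ ∈ Subgroup.center G := by
  have hg : g⁻¹ ^ 2 * h⁻¹ = h⁻¹ * g⁻¹ ^ 2 := (Subgroup.mem_center_iff.1 (hsq g⁻¹) h⁻¹).symm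
  have key : ⁅g, h⁆ = (g * h) ^ 2 * (g⁻¹ ^ 2 * h⁻¹ ^ 2) := by
    calc ⁅g, h⁆ = (g * h) ^ 2 * (h⁻¹ * g⁻¹ ^ 2 * h⁻¹) := by
          rw [commutatorElement_def]; simp [pow_two, mul_assoc]
      _ = (g * h) ^ 2 * (g⁻¹ ^ 2 * h⁻¹ ^ 2) := by rw [← hg, pow_two h⁻¹, mul_assoc]
  rw [key]
  exact mul_mem (hsq _) (mul_mem (hsq _) (hsq _))

/-- If squares are central, then the commutator is a central-valued symmetric bimultiplicative map
of exponent two. -/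
theorem exists_commutator_form (hsq : ∀ g : G, g ^ 2 ∈ Subgroup.center G) :
    ∃ B : G → G → Subgroup.center G, (∀ g h, g * h = (B g h : G) * (h * g)) ∧
      (∀ g h x, B (g * h) x = B g x * B h x) ∧ (∀ g h, B g h = B h g) ∧
      (∀ g h, B g h * B g h = 1) ∧ (∀ g, B g g = 1) ∧ ∀ g h, (B g h : G) = ⁅g, h⁆ := by
  let B : G → G → Subgroup.center G :=
    fun g h => ⟨⁅g, h⁆, commutatorElement_mem_center_of_sq_mem hsq g h⟩
  have hB : ∀ g h, (B g h : G) = ⁅g, h⁆ := fun _ _ => rfl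
  have hcomm : ∀ g h, g * h = (B g h : G) * (h * g) := fun g h => by
    rw [hB, commutatorElement_def]; group
  have hc : ∀ (z : Subgroup.center G) (x : G), x * z = z * x :=
    fun z => Subgroup.mem_center_iff.1 z.2
  have hmul : ∀ g h x, B (g * h) x = B g x * B h x := fun g h x => by
    apply Subtype.ext
    apply mul_right_cancel (b := x * (g * h))
    rw [← hcomm, mul_comm (B g x), Subgroup.coe_mul, mul_assoc g, hcomm h x, ← mul_assoc g, hc, mul_assoc,
      ← mul_assoc g x h, hcomm g x]
    simp only [mul_assoc]
  have hself : ∀ g, B g g = 1 := fun g => Subtype.ext (by simp [hB])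
  have hsq1 : ∀ g h, B g h * B g h = 1 := fun g h => by
    rw [← hmul]
    apply Subtype.ext
    rw [hB, Subgroup.coe_one, commutatorElement_eq_one_iff_mul_comm, ← pow_two]
    exact (Subgroup.mem_center_iff.1 (hsq g) h).symm
  have hsymm : ∀ g h, B g h = B h g := fun g h => by
    have : B g h = (B h g)⁻¹ := Subtype.ext (by simp [hB])
    rw [this, inv_eq_iff_mul_eq_one, hsq1]
  exact ⟨B, hcomm, hmul, hsymm, hsq1, hself, hB⟩

end CentralSquares

/-- A symmetric bimultiplicative map of exponent two for which no three elements have pairwise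
distinct nontrivial mutual values takes at most one nontrivial value. -/
theorem eq_of_ne_one_of_forall_triple {G A : Type*} [Mul G] [CommGroup A] {B : G → G → A}
    (hmul : ∀ g h x, B (g * h) x = B g x * B h x) (hsymm : ∀ g h, B g h = B h g)
    (hsq : ∀ g h, B g h * B g h = 1) (hself : ∀ g, B g g = 1)
    (htri : ∀ g h x, B g h = 1 ∨ B g x = 1 ∨ B h x = 1 ∨ B g h = B g x ∨ B g h = B h x ∨
      B g x = B h x) {g h x y : G} (hgh : B g h ≠ 1) (hxy : B x y ≠ 1) : B g h = B x y := by
  have hmul' : ∀ g h x, B x (g * h) = B x g * B x h := fun g h x => by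
    rw [hsymm, hmul, hsymm g, hsymm h]
  have hprod : ∀ {g h x y : G}, B g h * B x y = 1 → B g h = B x y := fun {g h x y} H => by
    rw [← mul_left_inj (B x y), H, hsq]
  have hrow : ∀ g h x, B g h ≠ 1 → B g x ≠ 1 → B g h = B g x := by
    intro g h x h1 h2
    by_contra hne
    have hab : B g h * B g x ≠ 1 := fun H => hne (hprod H)
    have hne' := Ne.symm hne
    by_cases c1 : B h x = 1
    -- With a = `B g h` and b = `B g x`, the triple chosen in each case has mutual values a, b, ab,
    -- which are distinct and nontrivial.
    · have := htri g (g * h) (g * x)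
      simp only [hmul, hmul', hself, c1, one_mul, mul_one, hsymm h g] at this
      rw [mul_comm] at hab
      simp_all
    by_cases c2 : B g h = B h x
    · have := htri g (g * h) x
      simp only [hmul, hmul', hself, ← c2, one_mul] at this
      rw [mul_comm] at hab
      simp_all
    by_cases c3 : B g x = B h x
    · have := htri g h (g * x)
      simp only [hmul', hself, ← c3, one_mul, hsymm h g] at this
      simp_all
    have := htri g h x
    tauto
  by_contra hne
  have cross : ∀ {g h x y : G}, B g h ≠ 1 → B x y ≠ 1 → B g h ≠ B x y → B g y = 1 := by
    intro g h x y h1 h2 h3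
    by_contra h4
    refine h3 ((hrow g h y h1 h4).trans ?_)
    rw [hsymm g, hsymm x]
    exact hrow y g x (by rwa [hsymm]) (by rwa [hsymm])
  have e1 : B g y = 1 := cross hgh hxy hne
  have e2 : B x h = 1 := cross hxy hgh (Ne.symm hne)
  -- As the cross values vanish, both values lie in the row of `g * x`.
  have := hrow (g * x) h y (by rwa [hmul, e2, mul_one]) (by rwa [hmul, e1, one_mul])
  rw [hmul, hmul, e1, e2, mul_one, one_mul] at this
  exact hne this

theorem card_commutator_le_two {G : Type*} [Group G]
    (hsq : ∀ g h : G, ⁅g, h⁆ * ⁅g, h⁆ = 1)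
    (heq : ∀ g h x y : G, ⁅g, h⁆ ≠ 1 → ⁅x, y⁆ ≠ 1 → ⁅g, h⁆ = ⁅x, y⁆) :
    Nat.card (commutator G) ≤ 2 := by
  obtain ⟨a, ha, hall⟩ : ∃ a : G, a * a = 1 ∧ ∀ g h : G, ⁅g, h⁆ = 1 ∨ ⁅g, h⁆ = a := by
    by_cases H : ∃ g h : G, ⁅g, h⁆ ≠ 1
    · obtain ⟨g, h, hgh⟩ := H
      exact ⟨⁅g, h⁆, hsq g h, fun x y => or_iff_not_imp_left.2 fun hxy => heq _ _ _ _ hxy hgh⟩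
    · push Not at H
      exact ⟨1, one_mul 1, fun g h => Or.inl (H g h)⟩
  have hle : commutator G ≤ Subgroup.zpowers a := by
    rw [commutator_eq_closure, Subgroup.closure_le]
    rintro _ ⟨g, h, rfl⟩
    rcases hall g h with H | H <;> rw [H]
    · exact one_mem _
    · exact Subgroup.mem_zpowers a
  have hfin : IsOfFinOrder a := isOfFinOrder_iff_pow_eq_one.2 ⟨2, two_pos, by rw [pow_two, ha]⟩
  have : Finite (Subgroup.zpowers a) := hfin.finite_zpowers
  calc Nat.card (commutator G) ≤ Nat.card (Subgroup.zpowers a) :=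
        Nat.card_mono (Set.toFinite _) hle
    _ = orderOf a := Nat.card_zpowers a
    _ ≤ 2 := orderOf_le_of_pow_eq_one two_pos (by rw [pow_two, ha])

/-- If squares are central and `g * h * g * x * g⁻¹` is a product of `g`, `h`, `x` in some order,
then two of the three mutual commutators coincide or one of them is trivial. -/
theorem commutator_form_triple {G : Type*} [Group G] {B : G → G → Subgroup.center G}
    (hcomm : ∀ g h, g * h = (B g h : G) * (h * g)) (hsq : ∀ g h, B g h * B g h = 1) {g h x : G}
    (H : g * h * g * x * g⁻¹ ∈ ClassSemigroup.productSet ({g} + {h} + {x})) :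
    B g h = 1 ∨ B g x = 1 ∨ B h x = 1 ∨ B g h = B g x ∨ B g h = B h x ∨ B g x = B h x := by
  have hc : ∀ (z : Subgroup.center G) (x y : G), x * (z * y) = z * (x * y) := fun z x y => by
    rw [← mul_assoc, Subgroup.mem_center_iff.1 z.2 x, mul_assoc]
  obtain ⟨a, ha⟩ : ∃ a, a = B g h := ⟨_, rfl⟩
  obtain ⟨b, hb⟩ : ∃ b, b = B g x := ⟨_, rfl⟩
  obtain ⟨c, hxc⟩ : ∃ c, c = B h x := ⟨_, rfl⟩
  have ha2 : a * a = 1 := ha ▸ hsq g h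
  have hb2 : b * b = 1 := hb ▸ hsq g x
  have hc2 : c * c = 1 := hxc ▸ hsq h x
  have hab : g * h = a * (h * g) := ha ▸ hcomm g h
  have hgx : g * x = b * (x * g) := hb ▸ hcomm g x
  have hhx : h * x = c * (x * h) := hxc ▸ hcomm h x
  rw [← ha, ← hb, ← hxc]
  have e1 : g * h * x = ((a * b * c : Subgroup.center G) : G) * (x * h * g) := by
    simp only [Subgroup.coe_mul, mul_assoc]
    rw [← mul_assoc g, hab, mul_assoc, mul_assoc, hgx, hc, ← mul_assoc h, hhx]
    simp only [mul_assoc]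
  have e2 : g * x * h = ((a * b : Subgroup.center G) : G) * (x * h * g) := by
    rw [hgx, mul_assoc, mul_assoc, hab, hc, mul_comm a, Subgroup.coe_mul]
    simp only [mul_assoc]
  have e3 : h * g * x = ((b * c : Subgroup.center G) : G) * (x * h * g) := by
    rw [mul_assoc, hgx, hc, ← mul_assoc h, hhx, Subgroup.coe_mul]
    simp only [mul_assoc]
  have e4 : h * x * g = (c : G) * (x * h * g) := by
    rw [hhx, mul_assoc]
  have e5 : x * g * h = (a : G) * (x * h * g) := by
    rw [mul_assoc, hab, hc, mul_assoc]
  have e6 : x * h * g = ((1 : Subgroup.center G) : G) * (x * h * g) := by simp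
  -- The six orderings have coefficients abc, ab, bc, c, a, 1 relative to xhg; `a * c` is the one
  -- subset product missing besides b, so each match forces a coincidence.
  have e0 : g * h * g * x * g⁻¹ = ((a * c : Subgroup.center G) : G) * (x * h * g) := by
    have h1 : g * h * g * x * g⁻¹ = b * (g * h * x) := by
      rw [mul_assoc _ g x, hgx, hc]
      group
    rw [h1, e1, ← mul_assoc, ← Subgroup.coe_mul, mul_right_comm a b c, mul_comm b, mul_assoc, hb2,
      mul_one]
  have cancel : ∀ {u v : Subgroup.center G}, (u : G) * (x * h * g) = v * (x * h * g) → u = v :=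
    fun H => Subtype.ext (mul_right_cancel H)
  rw [e0] at H
  rcases ClassSemigroup.productSet_triple H with H | H | H | H | H | H
  · rw [e1, mul_right_comm a b c] at H
    exact Or.inr (Or.inl (left_eq_mul.1 (cancel H)))
  · rw [e2] at H
    exact Or.inr (Or.inr (Or.inr (Or.inr (Or.inr (mul_left_cancel (cancel H)).symm))))
  · rw [e3] at H
    exact Or.inr (Or.inr (Or.inr (Or.inl (mul_right_cancel (cancel H)))))
  · rw [e4] at H
    exact Or.inl (mul_eq_right.1 (cancel H))
  · rw [e5] at H
    exact Or.inr (Or.inr (Or.inl (mul_eq_left.1 (cancel H))))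
  · have H' := cancel (H.trans e6)
    rw [← hc2] at H'
    exact Or.inr (Or.inr (Or.inr (Or.inr (Or.inl (mul_right_cancel H')))))

theorem theorem3p11 (G : Type*) [Group G] [Finite G]
    (hC : ClassSemigroup.IsClifford
      (ClassSemigroup (ClassSemigroup.productOneMonoid G))) :
    Nat.card (commutator G) ≤ 2 := by
  obtain ⟨B, hcomm, hmul, hsymm, hsq, hself, hB⟩ := exists_commutator_form (G := G)
    fun g => Subgroup.mem_center_iff.2 fun h => (hC.sq_mul_comm g h).symm
  refine card_commutator_le_two (fun g h => ?_) fun g h x y hgh hxy => ?_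
  · rw [← hB, ← Subgroup.coe_mul, hsq, Subgroup.coe_one]
  · rw [← hB, ← hB]
    rw [← hB, Ne, OneMemClass.coe_eq_one] at hgh hxy
    rw [eq_of_ne_one_of_forall_triple hmul hsymm hsq hself
      (fun g h x => commutator_form_triple hcomm hsq (hC.conj_mem_productSet g h x)) hgh hxy]
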